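/- Let $\mathcal F$ be a set of function symbols, each $f$ equipped with an arity $\alpha_f\ge 0$, and let $\mathcal X$ be an infinite set of variables. Terms are $t,u ::= f \mid x \mid t\,u \mid \lambda x.t$ ($f\in\mathcal F$, $x\in\mathcal X$), modulo $\alpha$-conversion; $t\sigma$ is the capture-avoiding application of a substitution $\sigma$. A term is *algebraic* if it contains no abstraction and no subterm $x\,t$ with $x$ a variable. A term is *arity-compliant* if it contains no subterm $f\,t_1\dots t_n$ with $n>\alpha_f$. A *rewrite relation* is a relation on terms closed under the term formation rules and under substitution; $\to_\beta$ is the smallest one with $(\lambda x.s)t\to_\beta s\{x\to t\}$. For a relation $\to$, write $s\downarrow t$ if $s\to^* w$ and $t\to^* w$ for some $w$; $\to$ is *confluent on* a set $S$ of terms if $t\downarrow t'$ whenever $s\in S$, $s\to^* t$ and $s\to^* t'$, and *confluent* if this holds for the set of all terms. A *conditional system* $\mathcal R$ is a set of rules $d_1=c_1\wedge\dots\wedge d_n=c_n\supset l\to r$ ($n\ge 0$), where $l$ is a non-variable algebraic term and all free variables of $r,d_i,c_i$ are free in $l$. Let $\to_{A}=\bigcup_{i}\to_{A_i}$ and $\to_{B}=\bigcup_{i}\to_{B_i}$,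 where $\to_{A_0}=\to_{B_0}=\emptyset$ and $\to_{A_{i+1}}$ (resp. $\to_{B_{i+1}}$) is the smallest rewrite relation containing $l\sigma\to r\sigma$ for every rule of $\mathcal R$ as above and every substitution $\sigma$ such that, for all $k$, $d_k\sigma\downarrow c_k\sigma$ with respect to $\to_{A_i}$ (resp. with respect to $\to_{\beta}\cup\to_{B_i}$). Assume that $\mathcal R$ is - *semi-closed*: every $c_i$ of every rule is algebraic and closed; - *left-linear*: no variable occurs twice in a left-hand side; - *algebraic*: all terms $l,r,d_i,c_i$ of its rules are algebraic; - *arity-compliant*: all terms $l,r,d_i,c_i$ of its rules are arity-compliant, and each left-hand side is of the form $f\,l_1\dots l_n$ with $n=\alpha_f$. Let $S$ be an *$\mathcal R$-stable* set of terms: $S$ contains only arity-compliant terms, is closed under subterms and under $\beta$-reduction, and, for every rule of $\mathcal R$ as above, every substitution $\sigma$ and every context $C$ (whose abstractions may bind variables of the term put in its hole), if $C[l\sigma]\in S$ then $C[r\sigma]\in S$ and $d_i\sigma,c_i\sigma\in S$ for all $i$. Then: 1. for every $s\in S$ and every term $t$ with $s\to^*_{\beta\cup B}t$ there are terms $a,b$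 with $s\to^*_\beta a\to^*_A b$ and $t\to_\beta^* b$; 2. if $\to_A$ is confluent, then $\to_{\beta\cup B}$ is confluent on $S$. -/

import Mathlib

universe u v

/-- Lambda-terms with constants in `F` and free variables in `V`, modulo alpha-conversion.
The body of an abstraction is a term over `Option V`, where `none` is the bound variable. -/
inductive Term (F : Type u) : Type v → Type (max u (v + 1))
  | fn {V : Type v} (f : F) : Term F V
  | var {V : Type v} (x : V) : Term F V
  | app {V : Type v} (s t : Term F V) : Term F V
  | lam {V : Type v} (b : Term F (Option V)) : Term F V

namespace Term

variable {F : Type u}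

/-- Renaming of the free variables. -/
def map : {V W : Type v} → (V → W) → Term F V → Term F W
  | _, _, _, fn f => fn f
  | _, _, ρ, var x => var (ρ x)
  | _, _, ρ, app s t => app (map ρ s) (map ρ t)
  | _, _, ρ, lam b => lam (map (Option.map ρ) b)

/-- The substitution `σ` pushed below a binder. -/
def liftSubst {V W : Type v} (σ : V → Term F W) : Option V → Term F (Option W)
  | none => var none
  | some x => map some (σ x)

/-- Capture-avoiding application `tσ` of a substitution. -/
def subst : {V W : Type v} → (V → Term F W) → Term F V → Term F W
  | _, _, _, fn f => fn f
  | _, _, σ, var x => σ x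
  | _, _, σ, app s t => app (subst σ s) (subst σ t)
  | _, _, σ, lam b => lam (subst (liftSubst σ) b)

/-- The list of the free occurrences of variables, from left to right. -/
def vars : {V : Type v} → Term F V → List V
  | _, fn _ => []
  | _, var x => [x]
  | _, app s t => vars s ++ vars t
  | _, lam b => (vars b).reduceOption

variable {X : Type v}

/-- The free variables of a term. -/
def fv (t : Term F X) : Set X := {x | x ∈ vars t}

/-- No free variable. -/
def IsClosed (t : Term F X) : Prop := fv t = ∅

/-- No variable has two free occurrences. -/
def IsLinear (t : Term F X) : Prop := (vars t).Nodup

/-- The term is a variable. -/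
def IsVar : Term F X → Prop
  | var _ => True
  | _ => False

/-- Algebraic terms: no abstraction, and no subterm `x t` with `x` a variable. -/
def IsAlgebraic : Term F X → Prop
  | fn _ => True
  | var _ => True
  | app s t => ¬ IsVar s ∧ IsAlgebraic s ∧ IsAlgebraic t
  | lam _ => False

/-- `s t₁ … tₙ`. -/
def apps (s : Term F X) (ts : List (Term F X)) : Term F X := ts.foldl app s

open Classical in
/-- The abstraction `λx.t` of the named variable `x`. -/
noncomputable def abs (x : X) (t : Term F X) : Term F X :=
  lam (map (fun y => if y = x then none else some y) t)

open Classical in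
/-- The substitution `{x → t}`. -/
noncomputable def single (x : X) (t : Term F X) : X → Term F X :=
  fun y => if y = x then t else var y

end Term

/-- Contexts: terms with exactly one hole. -/
inductive TermContext (F : Type u) (X : Type v) : Type (max u (v + 1))
  | hole : TermContext F X
  | appLeft (C : TermContext F X) (t : Term F X) : TermContext F X
  | appRight (t : Term F X) (C : TermContext F X) : TermContext F X
  | abs (x : X) (C : TermContext F X) : TermContext F X

/-- `C[t]`; the abstractions of `C` above the hole may bind variables of `t`. -/
noncomputable def TermContext.fill {F : Type u} {X : Type v} :
    TermContext F X → Term F X → Term F X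
  | hole, s => s
  | appLeft C t, s => (C.fill s).app t
  | appRight t C, s => t.app (C.fill s)
  | abs x C, s => Term.abs x (C.fill s)

/-- `s` is a subterm of `t`. Since terms are taken modulo alpha-conversion, a variable bound in
`t` above `s` may appear in `s` under any admissible name. -/
def Term.IsSubterm {F : Type u} {X : Type v} (s t : Term F X) : Prop :=
  ∃ C : TermContext F X, C.fill s = t

/-- With respect to the arities `α`, no subterm `f t₁ … tₙ` has `n > α f`. -/
def Term.IsArityCompliant {F : Type u} {X : Type v} (α : F → ℕ) (t : Term F X) : Prop :=
  ∀ (f : F) (ts : List (Term F X)), Term.IsSubterm (Term.apps (Term.fn f) ts) t → ts.length ≤ α f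

section Relations

variable {F : Type u} {X : Type v}

/-- The smallest rewrite relation containing `P`, that is, the smallest relation containing `P`
and closed under the term formation rules and under substitution. -/
inductive RewriteClosure (P : Term F X → Term F X → Prop) : Term F X → Term F X → Prop
  | base {s t : Term F X} (h : P s t) : RewriteClosure P s t
  | abs (x : X) {s t : Term F X} (h : RewriteClosure P s t) :
      RewriteClosure P (Term.abs x s) (Term.abs x t)
  | appLeft {s t : Term F X} (w : Term F X) (h : RewriteClosure P s t) :
      RewriteClosure P (s.app w) (t.app w)
  | appRight {s t : Term F X} (w : Term F X) (h : RewriteClosure P s t) :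
      RewriteClosure P (w.app s) (w.app t)
  | subst (σ : X → Term F X) {s t : Term F X} (h : RewriteClosure P s t) :
      RewriteClosure P (s.subst σ) (t.subst σ)

/-- Beta-reduction: the smallest rewrite relation with `(λx.s) t → s{x → t}`. -/
def Beta : Term F X → Term F X → Prop :=
  RewriteClosure fun a b => ∃ (x : X) (s t : Term F X),
    a = (Term.abs x s).app t ∧ b = s.subst (Term.single x t)

/-- Union of two relations. -/
def RelUnion (r r' : Term F X → Term F X → Prop) (s t : Term F X) : Prop := r s t ∨ r' s t

/-- Joinability: `s →* w *← t` for some `w`. -/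
def Joinable (r : Term F X → Term F X → Prop) (s t : Term F X) : Prop :=
  ∃ w, Relation.ReflTransGen r s w ∧ Relation.ReflTransGen r t w

/-- `r` is confluent on the set `S`. -/
def ConfluentOn (r : Term F X → Term F X → Prop) (S : Set (Term F X)) : Prop :=
  ∀ s ∈ S, ∀ t t', Relation.ReflTransGen r s t → Relation.ReflTransGen r s t' → Joinable r t t'

/-- `r` is confluent (on all terms). -/
def IsConfluent (r : Term F X → Term F X → Prop) : Prop := ConfluentOn r Set.univ

end Relations

/-- A conditional rewrite rule `d₁ = c₁ ∧ … ∧ dₙ = cₙ ⊃ lhs → rhs`; `conds` lists the pairs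
`(dᵢ, cᵢ)`. -/
structure CondRule (F : Type u) (X : Type v) where
  conds : List (Term F X × Term F X)
  lhs : Term F X
  rhs : Term F X
  lhs_algebraic : lhs.IsAlgebraic
  lhs_not_var : ¬ lhs.IsVar
  fv_rhs : rhs.fv ⊆ lhs.fv
  fv_conds : ∀ p ∈ conds, p.1.fv ⊆ lhs.fv ∧ p.2.fv ⊆ lhs.fv

/-- A conditional rewrite system is a set of conditional rewrite rules. -/
abbrev CondSystem (F : Type u) (X : Type v) := Set (CondRule F X)

namespace CondSystem

variable {F : Type u} {X : Type v}

/-- One level of conditional rewriting: the smallest rewrite relation with `lσ → rσ` for every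
rule and every `σ` such that `dᵢσ` and `cᵢσ` are `r`-joinable for all `i`. -/
def Level (R : CondSystem F X) (r : Term F X → Term F X → Prop) : Term F X → Term F X → Prop :=
  RewriteClosure fun a b => ∃ ρ ∈ R, ∃ σ : X → Term F X,
    (∀ p ∈ ρ.conds, Joinable r (p.1.subst σ) (p.2.subst σ)) ∧
      a = ρ.lhs.subst σ ∧ b = ρ.rhs.subst σ

/-- The relations `→_{A_i}`: conditions are evaluated without beta-reduction. -/
def StepAi (R : CondSystem F X) : ℕ → Term F X → Term F X → Prop
  | 0 => fun _ _ => False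
  | i + 1 => R.Level (StepAi R i)

/-- The join conditional rewrite relation `→_A`. -/
def StepA (R : CondSystem F X) (s t : Term F X) : Prop := ∃ i, R.StepAi i s t

/-- The relations `→_{B_i}`: conditions are evaluated with beta-reduction. -/
def StepBi (R : CondSystem F X) : ℕ → Term F X → Term F X → Prop
  | 0 => fun _ _ => False
  | i + 1 => R.Level (RelUnion (StepBi R i) Beta)

/-- The beta-standard conditional rewrite relation `→_B`. -/
def StepB (R : CondSystem F X) (s t : Term F X) : Prop := ∃ i, R.StepBi i s t

/-- Every `cᵢ` is algebraic and closed. -/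
def IsSemiClosed (R : CondSystem F X) : Prop :=
  ∀ ρ ∈ R, ∀ p ∈ ρ.conds, p.2.IsAlgebraic ∧ p.2.IsClosed

/-- Every left-hand side is linear. -/
def IsLeftLinear (R : CondSystem F X) : Prop := ∀ ρ ∈ R, ρ.lhs.IsLinear

/-- All rules are made of algebraic terms. -/
def IsAlgebraic (R : CondSystem F X) : Prop :=
  ∀ ρ ∈ R, ρ.lhs.IsAlgebraic ∧ ρ.rhs.IsAlgebraic ∧
    ∀ p ∈ ρ.conds, p.1.IsAlgebraic ∧ p.2.IsAlgebraic

/-- All terms of the rules are arity-compliant, and every left-hand side is a symbol `f` applied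
to exactly `α f` arguments. -/
def IsArityCompliant (α : F → ℕ) (R : CondSystem F X) : Prop :=
  ∀ ρ ∈ R, ρ.lhs.IsArityCompliant α ∧ ρ.rhs.IsArityCompliant α ∧
    (∃ (f : F) (ts : List (Term F X)),
      ρ.lhs = Term.apps (Term.fn f) ts ∧ ts.length = α f) ∧
    ∀ p ∈ ρ.conds, p.1.IsArityCompliant α ∧ p.2.IsArityCompliant α

/-- Almost `R`-stable sets of terms. -/
structure IsAlmostStable (α : F → ℕ) (R : CondSystem F X) (S : Set (Term F X)) : Prop where
  compliant : ∀ s ∈ S, s.IsArityCompliant α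
  subterm : ∀ s ∈ S, ∀ t : Term F X, t.IsSubterm s → t ∈ S
  beta : ∀ s ∈ S, ∀ t : Term F X, Beta s t → t ∈ S
  rule : ∀ ρ ∈ R, ∀ (C : TermContext F X) (σ : X → Term F X),
    C.fill (ρ.lhs.subst σ) ∈ S → C.fill (ρ.rhs.subst σ) ∈ S

/-- `R`-stable sets of terms. -/
structure IsStable (α : F → ℕ) (R : CondSystem F X) (S : Set (Term F X)) : Prop
    extends IsAlmostStable α R S where
  conds : ∀ ρ ∈ R, ∀ (C : TermContext F X) (σ : X → Term F X),
    C.fill (ρ.lhs.subst σ) ∈ S →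
      ∀ p ∈ ρ.conds, p.1.subst σ ∈ S ∧ p.2.subst σ ∈ S

end CondSystem

/-! The main tool is the complete development `dev`, which contracts all β-redexes of a term at
once. Its iterates are cofinal: if `s` reduces to `t` by β, then `t` reduces to some `dev^[n] s`
(`star_par_iterate_dev`). Two facts relate `→_{A_i}` to β.

First, `→_{A_i}` commutes with parallel β on all terms (`stepAi_par_commute`). A left-linear
algebraic pattern survives reduction inside `σ`, and conditions survive because a closed algebraic
right side only rewrites to abstraction-free, hence β-normal, terms.

Second, `dev` maps `→_{A_i}`-reductions to `→_{A_i}`-reductions on `S` (`star_stepAi_dev`). The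
danger is that `rσ` is an abstraction in function position, so that a step creates a β-redex. Arity
compliance forbids it, since `lσ` already has all its arguments.

By induction on `i`, a `B_i`-step on `S` becomes an `A_i`-step after enough developments of `σ`
(`exists_project_stepBi`), and this extends to mixed sequences (`exists_dev_of_star`): if `s →* t`
then `dev^[n] s →*_A b` and `t →*_β b`. For confluence, two such reductions are developed further
until they start from the same term, where confluence of `→_A` applies. -/

namespace Term

variable {F : Type u}

/-! ### Renaming and substitution. -/

theorem map_congr {V W : Type v} (t : Term F V) :
    ∀ {f g : V → W}, (∀ x ∈ vars t, f x = g x) → map f t = map g t := by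
  induction t generalizing W with
  | fn _ => intros; rfl
  | var x => intro f g h; simp [map, h x (by simp [vars])]
  | app s t ihs iht =>
    intro f g h
    simp only [map]
    rw [ihs fun x hx => h x (by simp [vars, hx]), iht fun x hx => h x (by simp [vars, hx])]
  | lam b ih =>
    intro f g h
    simp only [map]
    rw [ih]
    rintro (_ | x) hx
    · rfl
    · simp [h x (by simpa [vars, List.reduceOption_mem_iff] using hx)]

theorem map_id {V : Type v} (t : Term F V) : map id t = t := by
  induction t with
  | fn _ => rfl
  | var x => rfl
  | app s t ihs iht => simp [map, ihs, iht]
  | lam b ih => simp [map, ih]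

theorem map_map {V W U : Type v} (t : Term F V) (f : V → W) (g : W → U) :
    map g (map f t) = map (g ∘ f) t := by
  induction t generalizing W U with
  | fn _ => rfl
  | var x => rfl
  | app s t ihs iht => simp [map, ihs, iht]
  | lam b ih => simp [map, ih, Option.map_comp_map]

theorem subst_map {V W U : Type v} (t : Term F V) (f : V → W) (σ : W → Term F U) :
    subst σ (map f t) = subst (σ ∘ f) t := by
  induction t generalizing W U with
  | fn _ => rfl
  | var x => rfl
  | app s t ihs iht => simp [map, subst, ihs, iht]
  | lam b ih =>
    simp only [map, subst, ih]
    congr 2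
    funext o
    cases o <;> rfl

theorem map_subst {V W U : Type v} (t : Term F V) (σ : V → Term F W) (f : W → U) :
    map f (subst σ t) = subst (fun x => map f (σ x)) t := by
  induction t generalizing W U with
  | fn _ => rfl
  | var x => rfl
  | app s t ihs iht => simp [map, subst, ihs, iht]
  | lam b ih =>
    simp only [map, subst, ih]
    congr 2
    funext o
    cases o with
    | none => rfl
    | some x => simp only [liftSubst, map_map]; rfl

theorem liftSubst_var {V : Type v} : liftSubst (var : V → Term F V) = var := by
  funext o
  cases o <;> rfl

theorem subst_var {V : Type v} (t : Term F V) : subst var t = t := by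
  induction t with
  | fn _ => rfl
  | var x => rfl
  | app s t ihs iht => simp [subst, ihs, iht]
  | lam b ih => simp [subst, liftSubst_var, ih]

theorem subst_subst {V W U : Type v} (t : Term F V) (σ : V → Term F W) (τ : W → Term F U) :
    subst τ (subst σ t) = subst (fun x => subst τ (σ x)) t := by
  induction t generalizing W U with
  | fn _ => rfl
  | var x => rfl
  | app s t ihs iht => simp [subst, ihs, iht]
  | lam b ih =>
    simp only [subst, ih]
    congr 2
    funext o
    cases o with
    | none => rfl
    | some x => simp only [liftSubst, subst_map, map_subst]; rfl

theorem map_eq_subst {V W : Type v} (t : Term F V) (f : V → W) :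
    map f t = subst (fun x => var (f x)) t := by
  rw [← subst_var (map f t), subst_map]; rfl

/-- The substitution of `t` for the bound variable. -/
def inst {V : Type v} (t : Term F V) : Option V → Term F V
  | none => t
  | some x => var x

theorem subst_inst {V W : Type v} (b : Term F (Option V)) (t : Term F V) (σ : V → Term F W) :
    subst σ (subst (inst t) b) = subst (inst (subst σ t)) (subst (liftSubst σ) b) := by
  simp only [subst_subst]
  congr 1
  funext o
  cases o with
  | none => rfl
  | some x =>
    simp only [liftSubst, subst_map]
    exact (subst_var _).symm

theorem map_inst {V W : Type v} (b : Term F (Option V)) (t : Term F V) (f : V → W) :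
    map f (subst (inst t) b) = subst (inst (map f t)) (map (Option.map f) b) := by
  rw [map_subst, subst_map]
  congr 1
  funext o
  cases o <;> rfl

/-! ### Complete developments and parallel β-reduction. -/

/-- The term is an abstraction. -/
def IsLam {V : Type v} : Term F V → Prop
  | lam _ => True
  | _ => False

theorem isLam_map {V W : Type v} (f : V → W) (t : Term F V) : IsLam (map f t) ↔ IsLam t := by
  cases t <;> rfl

/-- The application of `s'` to `t'`, contracted if both `s` and `s'` are abstractions. -/
def devApp {V : Type v} : Term F V → Term F V → Term F V → Term F V
  | lam _, lam b', t' => subst (inst t') b'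
  | _, s', t' => app s' t'

/-- The complete development of all the beta-redexes of a term. -/
def dev : {V : Type v} → Term F V → Term F V
  | _, fn f => fn f
  | _, var x => var x
  | _, app s t => devApp s (dev s) (dev t)
  | _, lam b => lam (dev b)

theorem dev_app_lam {V : Type v} (b : Term F (Option V)) (t : Term F V) :
    dev (app (lam b) t) = subst (inst (dev t)) (dev b) := rfl

theorem dev_app {V : Type v} {s : Term F V} (hs : ¬ IsLam s) (t : Term F V) :
    dev (app s t) = app (dev s) (dev t) := by
  cases s with
  | lam b => exact absurd trivial hs
  | _ => rfl

theorem dev_map {V W : Type v} (f : V → W) (t : Term F V) : dev (map f t) = map f (dev t) := by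
  induction t generalizing W with
  | fn _ => rfl
  | var x => rfl
  | app s t ihs iht =>
    by_cases hs : IsLam s
    · cases s with
      | lam b =>
        have hb := ihs f
        simp only [map, dev, lam.injEq] at hb
        simp only [map, dev_app_lam, map_inst, hb, iht]
      | _ => exact hs.elim
    · rw [dev_app hs, map, dev_app (by rwa [isLam_map]), ihs, iht, map]
  | lam b ih => simp only [map, dev, ih]

/-- Parallel beta-reduction. -/
inductive Par : {V : Type v} → Term F V → Term F V → Prop
  | fn {V : Type v} (f : F) : Par (fn f : Term F V) (fn f)
  | var {V : Type v} (x : V) : Par (var x) (var x)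
  | app {V : Type v} {s s' t t' : Term F V} : Par s s' → Par t t' → Par (app s t) (app s' t')
  | lam {V : Type v} {b b' : Term F (Option V)} : Par b b' → Par (lam b) (lam b')
  | beta {V : Type v} {b b' : Term F (Option V)} {t t' : Term F V} :
      Par b b' → Par t t' → Par (app (lam b) t) (subst (inst t') b')

namespace Par

theorem refl {V : Type v} (t : Term F V) : Par t t := by
  induction t with
  | fn f => exact .fn f
  | var x => exact .var x
  | app _ _ ihs iht => exact .app ihs iht
  | lam _ ih => exact .lam ih

theorem map {V W : Type v} {s t : Term F V} (h : Par s t) (f : V → W) :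
    Par (s.map f) (t.map f) := by
  induction h generalizing W with
  | fn => exact .fn _
  | var x => exact .var _
  | app _ _ ihs iht => exact .app (ihs f) (iht f)
  | lam _ ih => exact .lam (ih _)
  | beta _ _ ihb iht => rw [map_inst]; exact .beta (ihb _) (iht f)

theorem liftSubst {V W : Type v} {σ τ : V → Term F W} (h : ∀ x, Par (σ x) (τ x)) (o : Option V) :
    Par (Term.liftSubst σ o) (Term.liftSubst τ o) := by
  cases o with
  | none => exact .var _
  | some x => exact (h x).map _

theorem subst {V W : Type v} {s t : Term F V} (h : Par s t) {σ τ : V → Term F W}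
    (hσ : ∀ x, Par (σ x) (τ x)) : Par (s.subst σ) (t.subst τ) := by
  induction h generalizing W with
  | fn f => exact .fn f
  | var x => exact hσ x
  | app _ _ ihs iht => exact .app (ihs hσ) (iht hσ)
  | lam _ ih => exact .lam (ih (liftSubst hσ))
  | beta _ _ ihb iht => rw [subst_inst]; exact .beta (ihb (liftSubst hσ)) (iht hσ)

theorem inst {V : Type v} {t t' : Term F V} (h : Par t t') (o : Option V) :
    Par (Term.inst t o) (Term.inst t' o) := by
  cases o with
  | none => exact h
  | some x => exact .var x

/-- Triangle property: whatever a parallel step left uncontracted can be contracted next. It yields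
the diamond property and, applied twice, the monotonicity `dev_dev`. -/
theorem dev {V : Type v} {s t : Term F V} (h : Par s t) : Par t (Term.dev s) := by
  induction h with
  | fn f => exact .fn f
  | var x => exact .var x
  | @app V s s' t t' hs _ ihs iht =>
    by_cases hl : IsLam s
    · cases s with
      | lam b =>
        cases hs with
        | lam hb =>
          cases ihs with
          | lam hb' => exact .beta hb' iht
      | _ => exact hl.elim
    · rw [dev_app hl]
      exact .app ihs iht
  | lam _ ih => exact .lam ih
  | beta _ _ ihb iht => exact ihb.subst iht.inst

theorem dev_dev {V : Type v} {s t : Term F V} (h : Par s t) : Par (Term.dev s) (Term.dev t) :=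
  h.dev.dev

theorem of_map {V W : Type v} (f : V → W) (s : Term F V) :
    ∀ {t : Term F W}, Par (s.map f) t → ∃ t', Par s t' ∧ t = t'.map f := by
  induction s generalizing W with
  | fn g => intro t h; cases h; exact ⟨_, .fn g, rfl⟩
  | var x => intro t h; cases h; exact ⟨_, .var x, rfl⟩
  | lam b ih =>
    intro t h
    cases h with
    | lam hb =>
      obtain ⟨b', hb', rfl⟩ := ih _ hb
      exact ⟨_, .lam hb', rfl⟩
  | app s u ihs ihu =>
    intro t h
    generalize hm : Term.map f (Term.app s u) = m at h
    cases h with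
    | fn | var | lam => cases hm
    | app h1 h2 =>
      simp only [Term.map, Term.app.injEq] at hm
      obtain ⟨rfl, rfl⟩ := hm
      obtain ⟨s', hs', rfl⟩ := ihs _ h1
      obtain ⟨u', hu', rfl⟩ := ihu _ h2
      exact ⟨_, .app hs' hu', rfl⟩
    | beta h1 h2 =>
      simp only [Term.map, Term.app.injEq] at hm
      obtain ⟨hm, rfl⟩ := hm
      obtain ⟨u', hu', rfl⟩ := ihu _ h2
      cases s with
      | lam b =>
        simp only [Term.map, Term.lam.injEq] at hm
        subst hm
        -- The induction hypothesis concerns the whole function part, so the step of the body is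
        -- wrapped in an abstraction and unwrapped afterwards.
        obtain ⟨s', hs', hs⟩ := ihs f (.lam h1)
        cases hs' with
        | lam hb =>
          simp only [Term.map, Term.lam.injEq] at hs
          subst hs
          exact ⟨_, .beta hb hu', (map_inst _ _ _).symm⟩
      | _ => cases hm

end Par

open Relation

theorem star_par_confluent {V : Type v} {s t t' : Term F V} (h : ReflTransGen Par s t)
    (h' : ReflTransGen Par s t') : ∃ w, ReflTransGen Par t w ∧ ReflTransGen Par t' w :=
  church_rosser (fun _ _ _ hb hc => ⟨_, .single hb.dev, .single hc.dev⟩) h h'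

theorem star_par_dev_iterate {V : Type v} (t : Term F V) (n : ℕ) :
    ReflTransGen Par t (dev^[n] t) := by
  induction n with
  | zero => exact .refl
  | succ n ih =>
    rw [Function.iterate_succ_apply']
    exact ih.tail (Par.refl _).dev

/-- Cofinality: each parallel step is absorbed by one more development, because `dev` is monotone
for `Par`. -/
theorem star_par_iterate_dev {V : Type v} {s t : Term F V} (h : ReflTransGen Par s t) :
    ∃ n, ReflTransGen Par t (dev^[n] s) := by
  induction h with
  | refl => exact ⟨0, .refl⟩
  | tail _ hc ih =>
    obtain ⟨n, hn⟩ := ih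
    refine ⟨n + 1, .head hc.dev ?_⟩
    rw [Function.iterate_succ_apply']
    exact hn.lift dev fun _ _ => Par.dev_dev

/-! ### Abstraction-free and algebraic terms. -/

/-- The term contains no abstraction. -/
def IsLamFree {V : Type v} : Term F V → Prop
  | fn _ => True
  | var _ => True
  | app s t => IsLamFree s ∧ IsLamFree t
  | lam _ => False

theorem IsLamFree.eq_of_par {V : Type v} {s t : Term F V} (hs : IsLamFree s) (h : Par s t) :
    t = s := by
  induction h with
  | fn | var => rfl
  | app _ _ ih1 ih2 => rw [ih1 hs.1, ih2 hs.2]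
  | lam => exact hs.elim
  | beta => exact hs.1.elim

theorem IsLamFree.eq_of_star_par {V : Type v} {s t : Term F V} (hs : IsLamFree s)
    (h : ReflTransGen Par s t) : t = s := by
  induction h with
  | refl => rfl
  | tail _ hc ih => subst ih; exact hs.eq_of_par hc

theorem IsLamFree.dev_iterate {V : Type v} {s : Term F V} (hs : IsLamFree s) (n : ℕ) :
    dev^[n] s = s :=
  hs.eq_of_star_par (star_par_dev_iterate s n)

theorem isLamFree_subst {V W : Type v} {σ : V → Term F W} {t : Term F V} (ht : IsLamFree t) :
    IsLamFree (t.subst σ) ↔ ∀ x ∈ vars t, IsLamFree (σ x) := by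
  induction t with
  | fn => simp [subst, vars, IsLamFree]
  | var => simp [subst, vars]
  | app s t ihs iht =>
    simp only [subst, vars, IsLamFree, ihs ht.1, iht ht.2, List.mem_append]
    exact ⟨fun h x hx => hx.elim (h.1 x) (h.2 x), fun h => ⟨fun x hx => h x (.inl hx),
      fun x hx => h x (.inr hx)⟩⟩
  | lam => exact ht.elim

variable {X : Type v}

theorem IsAlgebraic.isLamFree {t : Term F X} (ht : IsAlgebraic t) : IsLamFree t := by
  induction t with
  | fn | var => trivial
  | app s t ihs iht => exact ⟨ihs ht.2.1, iht ht.2.2⟩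
  | lam => exact ht.elim

theorem IsAlgebraic.subst_eq_self {t : Term F X} (ht : IsAlgebraic t) (hc : IsClosed t)
    (σ : X → Term F X) : t.subst σ = t := by
  induction t with
  | fn => rfl
  | var x =>
    have : x ∈ fv (var x : Term F _) := by simp [fv, vars]
    simp [show fv (var x : Term F _) = ∅ from hc] at this
  | app s t ihs iht =>
    have hc' : ∀ x, x ∉ fv (app s t) := by rw [hc]; simp
    rw [subst, ihs ht.2.1, iht ht.2.2]
    · exact Set.eq_empty_of_forall_notMem fun x hx => hc' x (by simp_all [fv, vars])
    · exact Set.eq_empty_of_forall_notMem fun x hx => hc' x (by simp_all [fv, vars])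
  | lam => exact ht.elim

theorem IsAlgebraic.not_isLam_subst {t : Term F X} (ht : IsAlgebraic t) (hv : ¬ IsVar t)
    {V : Type v} (σ : X → Term F V) : ¬ IsLam (t.subst σ) := by
  cases t with
  | fn | app => exact id
  | var => exact absurd trivial hv
  | lam => exact ht.elim

/-- Variables are never applied in an algebraic term, so every β-redex of the instance lies inside a
copy of some `σ x`. As `dev` is a function, all copies evolve alike and linearity plays no role. -/
theorem IsAlgebraic.dev_subst {t : Term F X} (ht : IsAlgebraic t) {V : Type v}
    (σ : X → Term F V) : dev (t.subst σ) = t.subst (dev ∘ σ) := by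
  induction t with
  | fn | var => rfl
  | app s t ihs iht =>
    rw [subst, dev_app (ht.2.1.not_isLam_subst ht.1 σ), ihs ht.2.1, iht ht.2.2, subst]
  | lam => exact ht.elim

theorem IsAlgebraic.dev_iterate_subst {t : Term F X} (ht : IsAlgebraic t) {V : Type v}
    (σ : X → Term F V) (n : ℕ) : dev^[n] (t.subst σ) = t.subst fun x => dev^[n] (σ x) := by
  induction n with
  | zero => rfl
  | succ n ih =>
    simp only [Function.iterate_succ_apply', ih, ht.dev_subst]; rfl

theorem IsAlgebraic.subst_congr {t : Term F X} (ht : IsAlgebraic t) {V : Type v}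
    {σ τ : X → Term F V} (h : ∀ x ∈ vars t, σ x = τ x) : t.subst σ = t.subst τ := by
  induction t with
  | fn => rfl
  | var x => exact h x (by simp [vars])
  | lam => exact ht.elim
  | app s t ihs iht =>
    rw [subst, ihs ht.2.1 fun x hx => h x (by simp [vars, hx]),
      iht ht.2.2 fun x hx => h x (by simp [vars, hx]), subst]

-- Different copies of `σ x` may be reduced differently; linearity rules this out and lets the
-- reducts be glued into one substitution.
open Classical in
theorem IsAlgebraic.par_subst_inv {t : Term F X} (ht : IsAlgebraic t) (hl : IsLinear t)
    {V : Type v} {σ : X → Term F V} {u : Term F V} (h : Par (t.subst σ) u) :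
    ∃ σ', (∀ x, Par (σ x) (σ' x)) ∧ (∀ x ∉ vars t, σ' x = σ x) ∧ u = t.subst σ' := by
  induction t generalizing u with
  | fn => cases h; exact ⟨σ, fun _ => .refl _, fun _ _ => rfl, rfl⟩
  | var x =>
    refine ⟨Function.update σ x u, fun y => ?_, fun y hy => ?_, ?_⟩
    · by_cases hy : y = x
      · subst hy; simpa [subst] using h
      · simpa [hy] using Par.refl _
    · have : y ≠ x := by simpa [vars] using hy
      simp [this]
    · simp [subst]
  | lam => exact ht.elim
  | app s t ihs iht =>
    have hl' := List.nodup_append.1 hl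
    have hns := ht.2.1.not_isLam_subst ht.1 σ
    generalize hm : subst σ (app s t) = m at h
    cases h with
    | fn | lam | var => cases hm
    | beta =>
      simp only [subst, app.injEq] at hm
      rw [hm.1] at hns
      exact absurd trivial hns
    | app h1 h2 =>
      simp only [subst, app.injEq] at hm
      obtain ⟨rfl, rfl⟩ := hm
      obtain ⟨σ₁, p1, e1, rfl⟩ := ihs ht.2.1 hl'.1 h1
      obtain ⟨σ₂, p2, e2, rfl⟩ := iht ht.2.2 hl'.2.1 h2
      refine ⟨fun x => if x ∈ vars s then σ₁ x else σ₂ x, fun x => ?_, fun x hx => ?_, ?_⟩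
      · dsimp only; split_ifs; exacts [p1 x, p2 x]
      · simp only [vars, List.mem_append, not_or] at hx
        simp [hx.1, e2 x hx.2]
      · rw [subst]
        congr 1
        · exact ht.2.1.subst_congr fun x hx => by simp [hx]
        · refine ht.2.2.subst_congr fun x hx => ?_
          have : x ∉ vars s := fun hs => hl'.2.2 x hs x hx rfl
          simp [this]

/-! ### Named abstractions and fresh names. -/

theorem dev_abs (x : X) (s : Term F X) : dev (abs x s) = abs x (dev s) := by
  rw [abs, dev, dev_map, abs]

theorem subst_inst_map_abs (x : X) (s u : Term F X) {b : Term F (Option X)}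
    (hb : abs x s = lam b) : b.subst (inst u) = s.subst (single x u) := by
  simp only [abs, lam.injEq] at hb
  rw [← hb, subst_map]
  congr 1
  funext y
  by_cases hy : y = x <;> simp [single, inst, hy]

theorem Par.abs_inv {x : X} {s t : Term F X} (h : Par (abs x s) t) :
    ∃ s', Par s s' ∧ t = abs x s' := by
  rw [abs] at h
  cases h with
  | lam hb =>
    obtain ⟨s', hs', rfl⟩ := of_map _ _ hb
    exact ⟨s', hs', rfl⟩

/-- Opens a binder under the name `x`, which must not capture the image of a free variable. This
passes from scoped bodies to the named `abs`. -/
theorem abs_map_elim {V : Type v} {x : X} (ρ : V → X) (b : Term F (Option V))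
    (hx : ∀ y, some y ∈ vars b → ρ y ≠ x) :
    abs x (b.map fun o => o.elim x ρ) = (lam b).map ρ := by
  rw [abs, map_map, map]
  congr 1
  refine map_congr _ ?_
  rintro (_ | y) hy
  · simp
  · simp [hx y hy]

theorem exists_fresh [Infinite X] {V : Type v} (ρ : V → X) (b b' : Term F (Option V)) :
    ∃ x, (∀ y, some y ∈ vars b → ρ y ≠ x) ∧ ∀ y, some y ∈ vars b' → ρ y ≠ x := by
  classical
  obtain ⟨x, hx⟩ := Infinite.exists_notMem_finset
    ((vars (lam b) ++ vars (lam b')).map ρ).toFinset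
  simp only [vars, List.map_append, List.toFinset_append, Finset.mem_union, List.mem_toFinset,
    List.mem_map, List.reduceOption_mem_iff, not_or, not_exists, not_and] at hx
  exact ⟨x, fun y hy => hx.1 y hy, fun y hy => hx.2 y hy⟩

end Term

section Rewriting

open Relation

variable {F : Type u} {X : Type v} {P Q : Term F X → Term F X → Prop}

open Term

/-! ### Rewrite closures and their redexes in context. -/

namespace RewriteClosure

theorem mono (h : ∀ s t, P s t → Q s t) {s t : Term F X} (hs : RewriteClosure P s t) :
    RewriteClosure Q s t := by
  induction hs with
  | base hp => exact .base (h _ _ hp)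
  | abs x _ ih => exact .abs x ih
  | appLeft w _ ih => exact .appLeft w ih
  | appRight w _ ih => exact .appRight w ih
  | subst σ _ ih => exact .subst σ ih

theorem star_abs (x : X) {s t : Term F X} (h : ReflTransGen (RewriteClosure P) s t) :
    ReflTransGen (RewriteClosure P) (Term.abs x s) (Term.abs x t) :=
  h.lift _ fun _ _ => .abs x

theorem star_app {s s' t t' : Term F X} (h : ReflTransGen (RewriteClosure P) s s')
    (h' : ReflTransGen (RewriteClosure P) t t') :
    ReflTransGen (RewriteClosure P) (s.app t) (s'.app t') :=
  (h.lift (fun a => a.app t) fun _ _ => .appLeft t).trans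
    (h'.lift (fun a => s'.app a) fun _ _ => .appRight s')

theorem star_fill (C : TermContext F X) {s t : Term F X}
    (h : ReflTransGen (RewriteClosure P) s t) :
    ReflTransGen (RewriteClosure P) (C.fill s) (C.fill t) := by
  induction C with
  | hole => exact h
  | appLeft C u ih => exact star_app ih .refl
  | appRight u C ih => exact star_app .refl ih
  | abs x C ih => exact star_abs x ih

theorem fill (C : TermContext F X) {s t : Term F X} (h : RewriteClosure P s t) :
    RewriteClosure P (C.fill s) (C.fill t) := by
  induction C with
  | hole => exact h
  | appLeft C u ih => exact .appLeft u ih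
  | appRight u C ih => exact .appRight u ih
  | abs x C ih => exact .abs x ih

theorem star_subst_of_star [Infinite X] {V : Type v} (s : Term F V) {σ τ : V → Term F X}
    (h : ∀ x, ReflTransGen (RewriteClosure P) (σ x) (τ x)) :
    ReflTransGen (RewriteClosure P) (s.subst σ) (s.subst τ) := by
  induction s with
  | fn => exact .refl
  | var x => exact h x
  | app _ _ ihs iht => exact star_app (ihs h) (iht h)
  | lam b ih =>
    obtain ⟨x, hx, hx'⟩ := exists_fresh id (b.subst (liftSubst σ)) (b.subst (liftSubst τ))
    have key : ∀ (μ : _ → Term F X), (∀ y, some y ∈ vars (b.subst (liftSubst μ)) → id y ≠ x) →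
        (Term.lam b).subst μ = Term.abs x (b.subst fun o => o.elim (Term.var x) μ) := by
      intro μ hμ
      rw [Term.subst, ← Term.map_id (Term.lam _), ← abs_map_elim id _ hμ, map_subst]
      congr 2
      funext o
      cases o with
      | none => rfl
      | some y =>
        simp only [liftSubst, Term.map_map]
        exact Term.map_id _
    rw [key σ hx, key τ hx']
    refine star_abs x (ih ?_)
    rintro (_ | y)
    · exact .refl
    · exact h y

end RewriteClosure

/-- The closure of the instances of `Q` under the term formation rules, at all scopes. -/
inductive CompatibleClosure (Q : Term F X → Term F X → Prop) :
    {V : Type v} → Term F V → Term F V → Prop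
  | base {V : Type v} {s t : Term F X} (σ : X → Term F V) (h : Q s t) :
      CompatibleClosure Q (s.subst σ) (t.subst σ)
  | lam {V : Type v} {b b' : Term F (Option V)} (h : CompatibleClosure Q b b') :
      CompatibleClosure Q (Term.lam b) (Term.lam b')
  | appLeft {V : Type v} {s t : Term F V} (w : Term F V) (h : CompatibleClosure Q s t) :
      CompatibleClosure Q (s.app w) (t.app w)
  | appRight {V : Type v} {s t : Term F V} (w : Term F V) (h : CompatibleClosure Q s t) :
      CompatibleClosure Q (w.app s) (w.app t)

namespace CompatibleClosure

theorem subst {V W : Type v} {s t : Term F V} (h : CompatibleClosure Q s t)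
    (τ : V → Term F W) : CompatibleClosure Q (s.subst τ) (t.subst τ) := by
  induction h generalizing W with
  | base σ h => rw [subst_subst, subst_subst]; exact .base _ h
  | lam _ ih => exact .lam (ih _)
  | appLeft w _ ih => exact .appLeft _ (ih τ)
  | appRight w _ ih => exact .appRight _ (ih τ)

theorem of_rewriteClosure {s t : Term F X} (h : RewriteClosure Q s t) :
    CompatibleClosure Q s t := by
  induction h with
  | @base s t h =>
    have := base Term.var h
    rwa [subst_var, subst_var] at this
  | abs x _ ih =>
    rw [Term.abs, Term.abs, map_eq_subst, map_eq_subst]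
    exact .lam (ih.subst _)
  | appLeft w _ ih => exact .appLeft w ih
  | appRight w _ ih => exact .appRight w ih
  | subst σ _ ih => exact ih.subst σ

/-- In `CompatibleClosure` substitutions occur only at the redex, so a context can be read off the
derivation; the renaming `ρ` lets the induction pass binders, each given a fresh name. -/
theorem exists_context [Infinite X]
    (hQ : ∀ s t (σ : X → Term F X), Q s t → Q (s.subst σ) (t.subst σ)) {V : Type v}
    {s t : Term F V} (h : CompatibleClosure Q s t) (ρ : V → X) :
    ∃ (C : TermContext F X) (a b : Term F X), Q a b ∧ s.map ρ = C.fill a ∧ t.map ρ = C.fill b := by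
  induction h with
  | @base V s t σ h =>
    rw [map_subst, map_subst]
    exact ⟨.hole, _, _, hQ _ _ _ h, rfl, rfl⟩
  | @lam V b b' _ ih =>
    obtain ⟨x, hx, hx'⟩ := exists_fresh ρ b b'
    obtain ⟨C, a, a', h, e, e'⟩ := ih fun o => o.elim x ρ
    refine ⟨.abs x C, a, a', h, ?_, ?_⟩
    · rw [← abs_map_elim ρ b hx, e]; rfl
    · rw [← abs_map_elim ρ b' hx', e']; rfl
  | appLeft w _ ih =>
    obtain ⟨C, a, b, h, e, e'⟩ := ih ρ
    exact ⟨.appLeft C (w.map ρ), a, b, h, by rw [Term.map, e]; rfl, by rw [Term.map, e']; rfl⟩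
  | appRight w _ ih =>
    obtain ⟨C, a, b, h, e, e'⟩ := ih ρ
    exact ⟨.appRight (w.map ρ) C, a, b, h, by rw [Term.map, e]; rfl, by rw [Term.map, e']; rfl⟩

end CompatibleClosure

theorem RewriteClosure.exists_context [Infinite X]
    (hQ : ∀ s t (σ : X → Term F X), Q s t → Q (s.subst σ) (t.subst σ)) {s t : Term F X}
    (h : RewriteClosure Q s t) :
    ∃ (C : TermContext F X) (a b : Term F X), Q a b ∧ s = C.fill a ∧ t = C.fill b := by
  have := (CompatibleClosure.of_rewriteClosure h).exists_context hQ id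
  rwa [Term.map_id, Term.map_id] at this

/-! ### Equivalence of β-reduction and parallel β-reduction. -/

theorem beta_lam [Infinite X] (b : Term F (Option X)) (t : Term F X) :
    Beta ((Term.lam b).app t) (b.subst (inst t)) := by
  obtain ⟨x, hx, -⟩ := exists_fresh id b b
  have hb := abs_map_elim id b hx
  rw [Term.map_id] at hb
  rw [subst_inst_map_abs x _ t hb, ← hb]
  exact .base ⟨x, _, t, rfl, rfl⟩

theorem Term.Par.star_beta_map [Infinite X] {V : Type v} {s t : Term F V} (h : Par s t)
    (ρ : V → X) : ReflTransGen Beta (s.map ρ) (t.map ρ) := by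
  have hlam : ∀ {V : Type v} {b b' : Term F (Option V)} (ρ : V → X),
      (∀ ρ : Option V → X, ReflTransGen Beta (b.map ρ) (b'.map ρ)) →
      ReflTransGen Beta ((Term.lam b).map ρ) ((Term.lam b').map ρ) := by
    intro V b b' ρ h
    obtain ⟨x, hx, hx'⟩ := exists_fresh ρ b b'
    rw [← abs_map_elim ρ b hx, ← abs_map_elim ρ b' hx']
    exact RewriteClosure.star_abs x (h _)
  induction h with
  | fn | var => exact .refl
  | app _ _ ihs iht => exact RewriteClosure.star_app (ihs ρ) (iht ρ)
  | lam _ ih => exact hlam ρ ih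
  | beta _ _ ihb iht =>
    rw [map_inst]
    exact (RewriteClosure.star_app (hlam ρ ihb) (iht ρ)).tail (beta_lam _ _)

theorem Term.Par.star_beta [Infinite X] {s t : Term F X} (h : Par s t) :
    ReflTransGen Beta s t := by
  have := h.star_beta_map id
  rwa [Term.map_id, Term.map_id] at this

theorem Beta.par {s t : Term F X} (h : Beta s t) : Par s t := by
  induction h with
  | base h =>
    obtain ⟨x, s, t, rfl, rfl⟩ := h
    rw [← subst_inst_map_abs x s t rfl]
    exact .beta (.refl _) (.refl _)
  | abs x _ ih => exact .lam (ih.map _)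
  | appLeft w _ ih => exact .app ih (.refl _)
  | appRight w _ ih => exact .app (.refl _) ih
  | subst σ _ ih => exact ih.subst fun _ => .refl _

theorem star_beta_iff_star_par [Infinite X] {s t : Term F X} :
    ReflTransGen Beta s t ↔ ReflTransGen Par s t := by
  refine ⟨fun h => ReflTransGen.mono (fun _ _ => Beta.par) _ _ h, fun h => ?_⟩
  induction h with
  | refl => exact .refl
  | tail _ hc ih => exact ih.trans hc.star_beta

/-! ### Commutation and projection through contexts. -/

/-- The tiling terminates because the local hypothesis leaves a single `Par` step on its side,
however many `r` steps it produces. -/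
theorem star_par_commute_of_commute {r : Term F X → Term F X → Prop}
    (h : ∀ s t s', r s t → Par s s' → ∃ t', ReflTransGen r s' t' ∧ Par t t') {s t s' : Term F X}
    (hst : ReflTransGen r s t) (hs : ReflTransGen Par s s') :
    ∃ t', ReflTransGen r s' t' ∧ ReflTransGen Par t t' := by
  have h1 : ∀ {s t s'}, ReflTransGen r s t → Par s s' → ∃ t', ReflTransGen r s' t' ∧ Par t t' := by
    intro s t s' hst
    induction hst using ReflTransGen.head_induction_on generalizing s' with
    | refl => exact fun hs => ⟨s', .refl, hs⟩
    | head hab _ ih =>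
      intro hs
      obtain ⟨u, hu, hp⟩ := h _ _ _ hab hs
      obtain ⟨w, hw, hp'⟩ := ih hp
      exact ⟨w, hu.trans hw, hp'⟩
  induction hs with
  | refl => exact ⟨t, hst, .refl⟩
  | tail _ hc ih =>
    obtain ⟨u, hu, hp⟩ := ih
    obtain ⟨w, hw, hp'⟩ := h1 hu hc
    exact ⟨w, hw, hp.tail hp'⟩

/-- A step from an abstraction takes place in its body. -/
def StepsUnderLam (r : Term F X → Term F X → Prop) : Prop :=
  ∀ b t, r (Term.lam b) t →
    ∃ b', t = Term.lam b' ∧ ∀ u, ReflTransGen r (b.subst (inst u)) (b'.subst (inst u))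

theorem StepsUnderLam.star {r : Term F X → Term F X → Prop} (h : StepsUnderLam r)
    {b : Term F (Option X)} {t : Term F X} (ht : ReflTransGen r (Term.lam b) t) :
    ∃ b', t = Term.lam b' ∧ ∀ u, ReflTransGen r (b.subst (inst u)) (b'.subst (inst u)) := by
  induction ht with
  | refl => exact ⟨b, rfl, fun _ => .refl⟩
  | tail _ hc ih =>
    obtain ⟨b₁, rfl, h₁⟩ := ih
    obtain ⟨b₂, rfl, h₂⟩ := h _ _ hc
    exact ⟨b₂, rfl, fun u => (h₁ u).trans (h₂ u)⟩

theorem TermContext.isLam_fill {a b : Term F X} (ha : ¬ IsLam a) {C : TermContext F X}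
    (h : IsLam (C.fill a)) : IsLam (C.fill b) := by
  cases C with
  | hole => exact absurd h ha
  | appLeft | appRight => exact h.elim
  | abs => trivial

/-- Since `a` is not an abstraction, it is not the function part of a contracted β-redex. If `b` is
an abstraction, the new redex is harmless: `Par` need not contract it. -/
theorem par_commute_context [Infinite X] {a b : Term F X} (ha : ¬ IsLam a)
    (hP : StepsUnderLam (RewriteClosure P))
    (h : ∀ s', Par a s' → ∃ t', ReflTransGen (RewriteClosure P) s' t' ∧ Par b t')
    (C : TermContext F X) {s' : Term F X} (hs : Par (C.fill a) s') :
    ∃ t', ReflTransGen (RewriteClosure P) s' t' ∧ Par (C.fill b) t' := by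
  induction C generalizing s' with
  | hole => exact h s' hs
  | abs x C ih =>
    obtain ⟨s', hs', rfl⟩ := Par.abs_inv hs
    obtain ⟨t', ht, hp⟩ := ih hs'
    exact ⟨_, RewriteClosure.star_abs x ht, .lam (hp.map _)⟩
  | appRight u C ih =>
    rw [TermContext.fill] at hs
    cases hs with
    | app h1 h2 =>
      obtain ⟨t', ht, hp⟩ := ih h2
      exact ⟨_, RewriteClosure.star_app .refl ht, .app h1 hp⟩
    | beta h1 h2 =>
      obtain ⟨t', ht, hp⟩ := ih h2
      refine ⟨_, RewriteClosure.star_subst_of_star _ (τ := inst t') ?_, .beta h1 hp⟩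
      rintro (_ | y)
      · exact ht
      · exact .refl
  | appLeft C u ih =>
    rw [TermContext.fill] at hs
    generalize hm : C.fill a = m at hs
    cases hs with
    | app h1 h2 =>
      obtain ⟨t', ht, hp⟩ := ih (hm ▸ h1)
      exact ⟨_, RewriteClosure.star_app ht .refl, .app hp h2⟩
    | beta h1 h2 =>
      -- The contracted abstraction belongs to `C`, so it is still there around `b`; `hP` carries
      -- the reduction of the abstraction over to the instantiated body.
      obtain ⟨t', ht, hp⟩ := ih (by rw [hm]; exact .lam h1)
      have hl : IsLam (C.fill b) := TermContext.isLam_fill ha (by rw [hm]; trivial)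
      obtain ⟨w, rfl, hw⟩ := hP.star ht
      rw [TermContext.fill]
      cases hb : C.fill b with
      | lam c =>
        rw [hb] at hp
        cases hp with
        | lam hp => exact ⟨_, hw _, .beta hp h2⟩
      | _ => rw [hb] at hl; exact hl.elim

/-- Unlike `Par`, `dev` is forced to contract a redex created by `b`. This could only happen with
the hole directly in function position, which `happ` excludes. -/
theorem star_dev_context [Infinite X] {S : Set (Term F X)}
    (hS : ∀ s ∈ S, ∀ t : Term F X, t.IsSubterm s → t ∈ S) {a b : Term F X}
    (happ : ∀ u, a.app u ∉ S) (hP : StepsUnderLam (RewriteClosure P))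
    (h : ReflTransGen (RewriteClosure P) (dev a) (dev b))
    (C : TermContext F X) (hC : C.fill a ∈ S) :
    ReflTransGen (RewriteClosure P) (dev (C.fill a)) (dev (C.fill b)) := by
  induction C with
  | hole => exact h
  | abs x C ih =>
    simp only [TermContext.fill, dev_abs]
    exact RewriteClosure.star_abs x (ih (hS _ hC _ ⟨.abs x .hole, rfl⟩))
  | appRight u C ih =>
    have ih := ih (hS _ hC _ ⟨.appRight u .hole, rfl⟩)
    simp only [TermContext.fill]
    by_cases hu : IsLam u
    · cases u with
      | lam c =>
        simp only [dev_app_lam]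
        refine RewriteClosure.star_subst_of_star _ ?_
        rintro (_ | y)
        · exact ih
        · exact .refl
      | _ => exact hu.elim
    · rw [dev_app hu, dev_app hu]
      exact RewriteClosure.star_app .refl ih
  | appLeft C u ih =>
    have ih := ih (hS _ hC _ ⟨.appLeft .hole u, rfl⟩)
    cases C with
    | hole => exact absurd hC (happ u)
    | appLeft C w =>
      simp only [TermContext.fill] at ih ⊢
      rw [dev_app (s := (C.fill a).app w) id, dev_app (s := (C.fill b).app w) id]
      exact RewriteClosure.star_app ih .refl
    | appRight w C =>
      simp only [TermContext.fill] at ih ⊢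
      rw [dev_app (s := w.app (C.fill a)) id, dev_app (s := w.app (C.fill b)) id]
      exact RewriteClosure.star_app ih .refl
    | abs x C =>
      simp only [TermContext.fill, Term.abs, dev_app_lam] at ih ⊢
      obtain ⟨b', hb', h'⟩ := hP.star ih
      cases hb'
      exact h' _

theorem Joinable.mono {r r' : Term F X → Term F X → Prop} (h : ∀ s t, r s t → r' s t)
    {s t : Term F X} (hj : Joinable r s t) : Joinable r' s t :=
  let ⟨w, h1, h2⟩ := hj
  ⟨w, ReflTransGen.mono h _ _ h1, ReflTransGen.mono h _ _ h2⟩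

/-- Closure under substitution. -/
def SubstStable (r : Term F X → Term F X → Prop) : Prop :=
  ∀ s t (σ : X → Term F X), r s t → r (s.subst σ) (t.subst σ)

/-! ### Levels of conditional rewriting and their commutation with β. -/

namespace CondSystem

variable {R : CondSystem F X}

theorem Level.mono {r r' : Term F X → Term F X → Prop} (h : ∀ s t, r s t → r' s t)
    {s t : Term F X} (hs : R.Level r s t) : R.Level r' s t :=
  RewriteClosure.mono (fun _ _ ⟨ρ, hρ, σ, hc, e⟩ => ⟨ρ, hρ, σ, fun p hp => (hc p hp).mono h, e⟩) hs

theorem Level.exists_context [Infinite X] {r : Term F X → Term F X → Prop} (hr : SubstStable r)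
    {s t : Term F X} (h : R.Level r s t) :
    ∃ ρ ∈ R, ∃ (C : TermContext F X) (σ : X → Term F X),
      (∀ p ∈ ρ.conds, Joinable r (p.1.subst σ) (p.2.subst σ)) ∧
        s = C.fill (ρ.lhs.subst σ) ∧ t = C.fill (ρ.rhs.subst σ) := by
  obtain ⟨C, a, b, ⟨ρ, hρ, σ, hc, rfl, rfl⟩, rfl, rfl⟩ := RewriteClosure.exists_context (by
    rintro _ _ τ ⟨ρ, hρ, σ, hc, rfl, rfl⟩
    refine ⟨ρ, hρ, fun x => (σ x).subst τ, fun p hp => ?_, subst_subst _ _ _, subst_subst _ _ _⟩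
    obtain ⟨w, h1, h2⟩ := hc p hp
    rw [← subst_subst, ← subst_subst]
    exact ⟨w.subst τ, h1.lift (Term.subst τ) fun _ _ => hr _ _ τ,
      h2.lift (Term.subst τ) fun _ _ => hr _ _ τ⟩) h
  exact ⟨ρ, hρ, C, σ, hc, rfl, rfl⟩

theorem substStable_stepAi : ∀ i, SubstStable (R.StepAi i)
  | 0 => fun _ _ _ h => h.elim
  | _ + 1 => fun _ _ σ h => RewriteClosure.subst σ h

theorem substStable_stepBi_beta : ∀ i, SubstStable (RelUnion (R.StepBi i) Beta)
  | 0 => fun _ _ σ h => h.elim False.elim fun h => .inr (RewriteClosure.subst σ h)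
  | _ + 1 => fun _ _ σ h =>
    h.elim (fun h => .inl (RewriteClosure.subst σ h)) fun h => .inr (RewriteClosure.subst σ h)

theorem stepBi_succ : ∀ (i : ℕ) {s t : Term F X}, R.StepBi i s t → R.StepBi (i + 1) s t
  | 0, _, _, h => h.elim
  | i + 1, _, _, h => Level.mono (fun _ _ => Or.imp_left (stepBi_succ i)) h

theorem stepBi_mono {i j : ℕ} (hij : i ≤ j) {s t : Term F X} (h : R.StepBi i s t) :
    R.StepBi j s t := by
  induction hij with
  | refl => exact h
  | step _ ih => exact stepBi_succ _ ih

theorem stepBi_of_stepAi : ∀ (i : ℕ) {s t : Term F X}, R.StepAi i s t → R.StepBi i s t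
  | 0, _, _, h => h.elim
  | i + 1, _, _, h => Level.mono (fun _ _ h => .inl (stepBi_of_stepAi i h)) h

theorem star_stepB_beta_level {s t : Term F X}
    (h : ReflTransGen (RelUnion Beta R.StepB) s t) :
    ∃ i, ReflTransGen (RelUnion (R.StepBi i) Beta) s t := by
  induction h with
  | refl => exact ⟨0, .refl⟩
  | tail _ hc ih =>
    obtain ⟨i, hi⟩ := ih
    rcases hc with hc | ⟨j, hj⟩
    · exact ⟨i, hi.tail (.inr hc)⟩
    · exact ⟨max i j, (ReflTransGen.mono (fun _ _ => Or.imp_left (stepBi_mono (le_max_left i j))) _ _ hi).tail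
        (.inl (stepBi_mono (le_max_right i j) hj))⟩

theorem not_isLam_lhs (ρ : CondRule F X) (σ : X → Term F X) : ¬ IsLam (ρ.lhs.subst σ) :=
  ρ.lhs_algebraic.not_isLam_subst ρ.lhs_not_var σ

/-- An instance of a left-hand side is never an abstraction, so the redex sits in the body, and the
step there is closed under substitution. -/
theorem stepsUnderLam_stepAi [Infinite X] : ∀ i, StepsUnderLam (R.StepAi i)
  | 0 => fun _ _ h => h.elim
  | i + 1 => fun b t h => by
    obtain ⟨ρ, hρ, C, σ, hc, e, rfl⟩ := Level.exists_context (substStable_stepAi i) h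
    cases C with
    | hole =>
      have := not_isLam_lhs ρ σ
      rw [show ρ.lhs.subst σ = _ from e.symm] at this
      exact absurd trivial this
    | appLeft | appRight => cases e
    | abs x C =>
      refine ⟨_, rfl, fun u => .single ?_⟩
      rw [subst_inst_map_abs x (C.fill (ρ.lhs.subst σ)) u e.symm,
        subst_inst_map_abs x (C.fill (ρ.rhs.subst σ)) u rfl]
      exact .subst _ (.fill C (.base ⟨ρ, hρ, σ, hc, rfl, rfl⟩))

/-- An abstraction in `rσ` would come from some `σ x` with `x` free in `r`, hence already occur in
`lσ`. -/
theorem isLamFree_of_stepAi [Infinite X] (halg : R.IsAlgebraic) {i : ℕ} {s t : Term F X}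
    (h : R.StepAi i s t) (hs : IsLamFree s) : IsLamFree t := by
  cases i with
  | zero => exact h.elim
  | succ i =>
    obtain ⟨ρ, hρ, C, σ, hc, rfl, rfl⟩ := Level.exists_context (substStable_stepAi i) h
    clear h
    induction C with
    | hole =>
      rw [TermContext.fill, isLamFree_subst ρ.lhs_algebraic.isLamFree] at hs
      rw [TermContext.fill, isLamFree_subst (halg ρ hρ).2.1.isLamFree]
      exact fun x hx => hs x (ρ.fv_rhs hx)
    | appLeft C u ih => exact ⟨ih hs.1, hs.2⟩
    | appRight u C ih => exact ⟨hs.1, ih hs.2⟩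
    | abs => exact hs.elim

theorem isLamFree_of_star_stepAi [Infinite X] (halg : R.IsAlgebraic) {i : ℕ} {s t : Term F X}
    (h : ReflTransGen (R.StepAi i) s t) (hs : IsLamFree s) : IsLamFree t := by
  induction h with
  | refl => exact hs
  | tail _ hc ih => exact isLamFree_of_stepAi halg hc ih

theorem stepAi_par_commute [Infinite X] (hsemi : R.IsSemiClosed) (hlin : R.IsLeftLinear)
    (halg : R.IsAlgebraic) : ∀ (i : ℕ) (s t s' : Term F X), R.StepAi i s t → Par s s' →
      ∃ t', ReflTransGen (R.StepAi i) s' t' ∧ Par t t'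
  | 0, _, _, _, h => h.elim
  | i + 1, s, t, s', h => by
    intro hp
    obtain ⟨ρ, hρ, C, σ, hc, rfl, rfl⟩ := Level.exists_context (substStable_stepAi i) h
    refine par_commute_context (not_isLam_lhs ρ σ) (stepsUnderLam_stepAi (i + 1)) ?_ C hp
    intro u hu
    obtain ⟨τ, hτ, -, rfl⟩ := ρ.lhs_algebraic.par_subst_inv (hlin ρ hρ) hu
    refine ⟨_, .single (.base ⟨ρ, hρ, τ, fun p hp => ?_, rfl, rfl⟩), (Par.refl _).subst hτ⟩
    obtain ⟨w, h1, h2⟩ := hc p hp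
    have hcl := hsemi ρ hρ p hp
    rw [hcl.1.subst_eq_self hcl.2] at h2 ⊢
    obtain ⟨w', h3, h4⟩ := star_par_commute_of_commute
      (stepAi_par_commute hsemi hlin halg i) h1 (.single ((Par.refl p.1).subst hτ))
    -- The common reduct `w` comes from the closed algebraic side, so it is β-normal and its
    -- parallel reduct is `w` itself.
    rw [(isLamFree_of_star_stepAi halg h2 hcl.1.isLamFree).eq_of_star_par h4] at h3
    exact ⟨w, h3, h2⟩

/-! ### Projection onto `→_A` over stable sets. -/

section Stable

variable {α : F → ℕ} {S : Set (Term F X)}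

theorem IsAlmostStable.star_beta (hS : R.IsAlmostStable α S) {s t : Term F X} (hs : s ∈ S)
    (h : ReflTransGen Beta s t) : t ∈ S := by
  induction h with
  | refl => exact hs
  | tail _ hc ih => exact hS.beta _ ih _ hc

theorem IsAlmostStable.dev_iterate [Infinite X] (hS : R.IsAlmostStable α S) {s : Term F X}
    (hs : s ∈ S) (n : ℕ) : dev^[n] s ∈ S :=
  hS.star_beta hs (star_beta_iff_star_par.2 (star_par_dev_iterate s n))

theorem IsAlmostStable.level [Infinite X] (hS : R.IsAlmostStable α S)
    {r : Term F X → Term F X → Prop} (hr : SubstStable r) {s t : Term F X} (hs : s ∈ S)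
    (h : R.Level r s t) : t ∈ S := by
  obtain ⟨ρ, hρ, C, σ, -, rfl, rfl⟩ := h.exists_context hr
  exact hS.rule ρ hρ C σ hs

theorem IsAlmostStable.stepAi [Infinite X] (hS : R.IsAlmostStable α S) :
    ∀ {i : ℕ} {s t : Term F X}, s ∈ S → R.StepAi i s t → t ∈ S
  | 0, _, _, _, h => h.elim
  | i + 1, _, _, hs, h => hS.level (substStable_stepAi i) hs h

theorem IsAlmostStable.stepBi [Infinite X] (hS : R.IsAlmostStable α S) :
    ∀ {i : ℕ} {s t : Term F X}, s ∈ S → R.StepBi i s t → t ∈ S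
  | 0, _, _, _, h => h.elim
  | i + 1, _, _, hs, h => hS.level (substStable_stepBi_beta i) hs h

theorem apps_subst (s : Term F X) (ts : List (Term F X)) (σ : X → Term F X) :
    (apps s ts).subst σ = apps (s.subst σ) (ts.map (Term.subst σ)) := by
  induction ts generalizing s with
  | nil => rfl
  | cons t ts ih => exact ih (s.app t)

theorem app_lhs_notMem (harity : R.IsArityCompliant α) (hS : R.IsAlmostStable α S)
    {ρ : CondRule F X} (hρ : ρ ∈ R) (σ : X → Term F X) (u : Term F X) :
    (ρ.lhs.subst σ).app u ∉ S := by
  intro hu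
  obtain ⟨f, ts, e, hlen⟩ := (harity ρ hρ).2.2.1
  have := hS.compliant _ hu f (ts.map (Term.subst σ) ++ [u]) ⟨.hole, by
    rw [e, apps_subst, TermContext.fill, apps, List.foldl_append]; rfl⟩
  simp [hlen] at this

/-- On stable sets, complete developments project the steps of `→_{A_i}`. -/
theorem star_stepAi_dev [Infinite X] (hsemi : R.IsSemiClosed) (halg : R.IsAlgebraic)
    (harity : R.IsArityCompliant α) (hS : R.IsStable α S) :
    ∀ (i : ℕ) {s t : Term F X}, s ∈ S → ReflTransGen (R.StepAi i) s t →
      ReflTransGen (R.StepAi i) (dev s) (dev t) := by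
  intro i
  induction i with
  | zero =>
    intro s t _ h
    induction h with
    | refl => exact .refl
    | tail _ hc _ => exact hc.elim
  | succ i IH =>
    intro s t hs h
    induction h using ReflTransGen.head_induction_on with
    | refl => exact .refl
    | head hab _ ih =>
      refine .trans ?_ (ih (hS.toIsAlmostStable.stepAi hs hab))
      obtain ⟨ρ, hρ, C, σ, hc, rfl, rfl⟩ := Level.exists_context (substStable_stepAi i) hab
      refine star_dev_context hS.subterm
        (app_lhs_notMem harity hS.toIsAlmostStable hρ σ) (stepsUnderLam_stepAi (i + 1)) ?_ C hs
      obtain ⟨hl, hr, hd⟩ := halg ρ hρ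
      rw [hl.dev_subst, hr.dev_subst]
      refine .single (.base ⟨ρ, hρ, _, fun p hp => ?_, rfl, rfl⟩)
      obtain ⟨w, h1, h2⟩ := hc p hp
      have hcl := hsemi ρ hρ p hp
      rw [hcl.1.subst_eq_self hcl.2] at h2 ⊢
      -- The recursion on conditions stays inside `S`: this is what stability adds to almost
      -- stability.
      have h3 := IH (hS.conds ρ hρ C σ hs p hp).1 h1
      rw [(hd p hp).1.dev_subst] at h3
      have hw := (isLamFree_of_star_stepAi halg h2 hcl.1.isLamFree).eq_of_par (Par.refl w).dev
      rw [hw] at h3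
      exact ⟨w, h3, h2⟩

theorem star_stepAi_dev_iterate [Infinite X] (hsemi : R.IsSemiClosed) (halg : R.IsAlgebraic)
    (harity : R.IsArityCompliant α) (hS : R.IsStable α S) (i n : ℕ) {s t : Term F X}
    (hs : s ∈ S) (h : ReflTransGen (R.StepAi i) s t) :
    ReflTransGen (R.StepAi i) (dev^[n] s) (dev^[n] t) := by
  induction n with
  | zero => exact h
  | succ n ih =>
    simp only [Function.iterate_succ_apply']
    exact star_stepAi_dev hsemi halg harity hS i (hS.toIsAlmostStable.dev_iterate hs n) ih

/-- The projection of one step of `→_{B_i}` extends to sequences of `β ∪ B_i` steps. -/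
theorem exists_dev_of_star [Infinite X] (hsemi : R.IsSemiClosed) (hlin : R.IsLeftLinear)
    (halg : R.IsAlgebraic) (harity : R.IsArityCompliant α) (hS : R.IsStable α S) {i : ℕ}
    (hproj : ∀ s t, s ∈ S → R.StepBi i s t → ∃ s' t', ReflTransGen Par s s' ∧
      ReflTransGen (R.StepAi i) s' t' ∧ ReflTransGen Par t t') {s t : Term F X} (hs : s ∈ S)
    (h : ReflTransGen (RelUnion (R.StepBi i) Beta) s t) :
    ∃ n b, ReflTransGen (R.StepAi i) (dev^[n] s) b ∧ ReflTransGen Par t b := by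
  have hcomm := stepAi_par_commute hsemi hlin halg i
  have key : t ∈ S ∧ ∃ n b, ReflTransGen (R.StepAi i) (dev^[n] s) b ∧ ReflTransGen Par t b := by
    induction h with
    | refl => exact ⟨hs, 0, s, .refl, .refl⟩
    | @tail t t' _ hc ih =>
      obtain ⟨ht, n, b, hb, htb⟩ := ih
      have hn := hS.toIsAlmostStable.dev_iterate hs n
      rcases hc with hc | hc
      · refine ⟨hS.toIsAlmostStable.stepBi ht hc, ?_⟩
        obtain ⟨s₁, t₁, hs₁, hst, ht₁⟩ := hproj _ _ ht hc
        -- A development of `s` is known to reach `b` by `→_{A_i}`, but not `b'`. The diagram is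
        -- therefore pushed on to `dev^[k] b`, reachable by projecting `hb`.
        obtain ⟨b', hbb', hsb'⟩ := star_par_confluent htb hs₁
        obtain ⟨v, hv, htv⟩ := star_par_commute_of_commute hcomm hst hsb'
        obtain ⟨k, hk⟩ := star_par_iterate_dev hbb'
        obtain ⟨v', hv', hvv'⟩ := star_par_commute_of_commute hcomm hv hk
        refine ⟨k + n, v', ?_, ht₁.trans (htv.trans hvv')⟩
        rw [Function.iterate_add_apply]
        exact (star_stepAi_dev_iterate hsemi halg harity hS i k hn hb).trans hv'
      · refine ⟨hS.beta _ ht _ hc, ?_⟩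
        obtain ⟨b', hbb', htb'⟩ := star_par_confluent htb (.single hc.par)
        obtain ⟨k, hk⟩ := star_par_iterate_dev hbb'
        refine ⟨k + n, dev^[k] b, ?_, htb'.trans hk⟩
        rw [Function.iterate_add_apply]
        exact star_stepAi_dev_iterate hsemi halg harity hS i k hn hb
  exact key.2

/-- Developing `σ` often enough turns each condition, joinable with β, into one joinable by
`→_{A_i}` alone; the rule then fires on the developed instance. -/
theorem exists_project_stepBi [Infinite X] (hsemi : R.IsSemiClosed) (hlin : R.IsLeftLinear)
    (halg : R.IsAlgebraic) (harity : R.IsArityCompliant α) (hS : R.IsStable α S) (i : ℕ) :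
    ∀ s t, s ∈ S → R.StepBi i s t → ∃ s' t', ReflTransGen Par s s' ∧
      ReflTransGen (R.StepAi i) s' t' ∧ ReflTransGen Par t t' := by
  induction i with
  | zero => exact fun _ _ _ h => h.elim
  | succ i IH =>
    intro s t hs h
    have hstar := fun {s t} => exists_dev_of_star hsemi hlin halg harity hS IH (s := s) (t := t)
    obtain ⟨ρ, hρ, C, σ, hc, rfl, rfl⟩ := Level.exists_context (substStable_stepBi_beta i) h
    obtain ⟨hl, hr, hd⟩ := halg ρ hρ
    have hone : ∀ p ∈ ρ.conds, ∃ n w, IsLamFree w ∧ ReflTransGen (R.StepAi i) p.2 w ∧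
        ReflTransGen (R.StepAi i) (dev^[n] (p.1.subst σ)) w := by
      intro p hp
      obtain ⟨hdS, hcS⟩ := hS.conds ρ hρ C σ hs p hp
      have hcl := hsemi ρ hρ p hp
      obtain ⟨w, h1, h2⟩ := hc p hp
      rw [hcl.1.subst_eq_self hcl.2] at h2 hcS
      obtain ⟨n, b₁, hb₁, hw₁⟩ := hstar hdS h1
      obtain ⟨m, b₂, hb₂, hw₂⟩ := hstar hcS h2
      rw [hcl.1.isLamFree.dev_iterate] at hb₂
      have hfree := isLamFree_of_star_stepAi halg hb₂ hcl.1.isLamFree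
      -- Both `b₁` and `b₂` are β-reducts of `w`, and `b₂` is β-normal, so `b₁` β-reduces to `b₂`,
      -- and some iterate of `dev` sends `b₁` to `b₂`.
      obtain ⟨v, hv₁, hv₂⟩ := star_par_confluent hw₁ hw₂
      rw [hfree.eq_of_star_par hv₂] at hv₁
      obtain ⟨k, hk⟩ := star_par_iterate_dev hv₁
      refine ⟨k + n, b₂, hfree, hb₂, ?_⟩
      rw [Function.iterate_add_apply, ← hfree.eq_of_star_par hk]
      exact star_stepAi_dev_iterate hsemi halg harity hS i k
        (hS.toIsAlmostStable.dev_iterate hdS n) hb₁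
    have : Nonempty (Term F X) := ⟨ρ.lhs⟩
    choose! n w hfree hcw hdw using hone
    -- One substitution must serve all conditions. Any bound on the `n p` works, because extra
    -- developments fix the abstraction-free `w p`.
    let N := (ρ.conds.map n).sum
    have hN : ∀ p ∈ ρ.conds, n p ≤ N := fun p hp =>
      List.single_le_sum (by simp) _ (List.mem_map_of_mem hp)
    refine ⟨C.fill (ρ.lhs.subst fun x => dev^[N] (σ x)),
      C.fill (ρ.rhs.subst fun x => dev^[N] (σ x)), ?_,
      .single (.fill C (.base ⟨ρ, hρ, _, fun p hp => ⟨w p, ?_, ?_⟩, rfl, rfl⟩)), ?_⟩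
    · rw [← hl.dev_iterate_subst, ← star_beta_iff_star_par]
      exact RewriteClosure.star_fill C (star_beta_iff_star_par.2 (star_par_dev_iterate _ N))
    · rw [← (hd p hp).1.dev_iterate_subst, ← Nat.sub_add_cancel (hN p hp),
        Function.iterate_add_apply, ← (hfree p hp).dev_iterate (N - n p)]
      exact star_stepAi_dev_iterate hsemi halg harity hS i _
        (hS.toIsAlmostStable.dev_iterate (hS.conds ρ hρ C σ hs p hp).1 _) (hdw p hp)
    · have hcl := hsemi ρ hρ p hp
      rw [hcl.1.subst_eq_self hcl.2]
      exact hcw p hp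
    · rw [← hr.dev_iterate_subst, ← star_beta_iff_star_par]
      exact RewriteClosure.star_fill C (star_beta_iff_star_par.2 (star_par_dev_iterate _ N))

end Stable

end CondSystem

end Rewriting

/-! ### Decomposition and confluence. -/

/-- For an arity-compliant, semi-closed, left-linear, algebraic conditional system `R` and an
`R`-stable set `S`: on `S` every `β ∪ B`-reduction `s →* t` decomposes as
`s →*_β a →*_A b *←_β t`, and if `→_A` is confluent then `→_{β ∪ B}` is confluent on `S`. -/
theorem theorem3 {F : Type u} {X : Type v} [Infinite X] (α : F → ℕ) (R : CondSystem F X)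
    (hsemi : R.IsSemiClosed) (hlin : R.IsLeftLinear) (halg : R.IsAlgebraic)
    (harity : R.IsArityCompliant α) (S : Set (Term F X)) (hS : R.IsStable α S) :
    (∀ s ∈ S, ∀ t : Term F X, Relation.ReflTransGen (RelUnion Beta R.StepB) s t →
      ∃ a b : Term F X, Relation.ReflTransGen Beta s a ∧ Relation.ReflTransGen R.StepA a b ∧
        Relation.ReflTransGen Beta t b) ∧
    (IsConfluent R.StepA → ConfluentOn (RelUnion Beta R.StepB) S) := by
  have hdecomp : ∀ s ∈ S, ∀ t, Relation.ReflTransGen (RelUnion Beta R.StepB) s t →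
      ∃ i n b, Relation.ReflTransGen (R.StepAi i) (Term.dev^[n] s) b ∧
        Relation.ReflTransGen Term.Par t b := by
    intro s hs t h
    obtain ⟨i, hi⟩ := CondSystem.star_stepB_beta_level h
    exact ⟨i, CondSystem.exists_dev_of_star hsemi hlin halg harity hS
      (CondSystem.exists_project_stepBi hsemi hlin halg harity hS i) hs hi⟩
  have hA : ∀ {i : ℕ} {s t : Term F X}, Relation.ReflTransGen (R.StepAi i) s t →
      Relation.ReflTransGen R.StepA s t := 
    Relation.ReflTransGen.mono (fun _ _ h => ⟨_, h⟩) _ _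
  refine ⟨fun s hs t h => ?_, fun hconf s hs t t' h h' => ?_⟩
  · obtain ⟨i, n, b, hb, ht⟩ := hdecomp s hs t h
    exact ⟨_, b, star_beta_iff_star_par.2 (Term.star_par_dev_iterate s n), hA hb,
      star_beta_iff_star_par.2 ht⟩
  · obtain ⟨i, n, b, hb, ht⟩ := hdecomp s hs t h
    obtain ⟨j, m, b', hb', ht'⟩ := hdecomp s hs t' h'
    -- Crossing the exponents, `m` on the first reduction and `n` on the second, gives both the
    -- source `dev^[m + n] s`.
    have h1 := CondSystem.star_stepAi_dev_iterate hsemi halg harity hS i m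
      (hS.toIsAlmostStable.dev_iterate hs n) hb
    have h2 := CondSystem.star_stepAi_dev_iterate hsemi halg harity hS j n
      (hS.toIsAlmostStable.dev_iterate hs m) hb'
    rw [← Function.iterate_add_apply] at h1 h2
    rw [Nat.add_comm] at h2
    obtain ⟨w, hw, hw'⟩ := hconf _ (Set.mem_univ _) _ _ (hA h1) (hA h2)
    have hjoin : ∀ {t b : Term F X} (k : ℕ), Relation.ReflTransGen Term.Par t b →
        Relation.ReflTransGen R.StepA (Term.dev^[k] b) w →
        Relation.ReflTransGen (RelUnion Beta R.StepB) t w := fun k ht hw =>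
      (Relation.ReflTransGen.mono (fun _ _ => Or.inl) _ _
        (star_beta_iff_star_par.2 (ht.trans (Term.star_par_dev_iterate _ k)))).trans
          (Relation.ReflTransGen.mono
            (fun _ _ ⟨i, h⟩ => Or.inr ⟨i, CondSystem.stepBi_of_stepAi i h⟩) _ _ hw)
    exact ⟨w, hjoin m ht hw, hjoin n ht' hw'⟩
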